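/- Let $(Y_i)_{i\in\mathbb N}$ be a sequence of (complex) operator spaces, each of which is completely isomorphic to $\mathrm{MIN}(\ell_2)$ (no uniform bound on the isomorphism constants is assumed). If $X\in\{R,\;C,\;R\cap C,\;\mathrm{MAX}(\ell_2)\}$, then $X$ does not completely isomorphically embed into $\left(\bigoplus_i Y_i\right)_{c_0}$. Here an operator space is a complex Banach space $X$ with a linear isometric embedding into $B(H)$ for some Hilbert space $H$, and the norm $\|\cdot\|_{M_n(X)}$ is the one induced by $M_n(X)\subseteq M_n(B(H))\cong B(H^{\oplus n})$. A linear map $f\colon X\to Z$ of operator spaces is completely bounded if its amplifications $[x_{kl}]\mapsto[f(x_{kl})]$, $M_n(X)\to M_n(Z)$, are bounded uniformly in $n$. It is a complete isomorphic embedding if moreover it is injective and its inverse, defined on its range, is completely bounded, and a complete isomorphism if in addition it is onto. The $c_0$-sum $\left(\bigoplus_i Y_i\right)_{c_0}$ consists of the sequences $(y_i)_i$ with $y_i\in Y_i$ and $\lim_i\|y_i\|=0$, with $\|[x_{kl}]\|_{M_n}=\sup_i\|[x_{kl}(i)]\|_{M_n(Y_i)}$. With $(e_{ij})$ the matrix units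 of $B(\ell_2)$, $R=\overline{\mathrm{span}}\{e_{1i}\colon i\in\mathbb N\}$ and $C=\overline{\mathrm{span}}\{e_{i1}\colon i\in\mathbb N\}$ in $B(\ell_2)$. $R\cap C$ is $\ell_2$ with the structure induced by $x\mapsto(r(x),c(x))\in R\oplus_\infty C$, where $r\colon\ell_2\to R$ and $c\colon\ell_2\to C$ are the linear isometries with $r(e_i)=e_{1i}$ and $c(e_i)=e_{i1}$. For a Banach space $E$, $\mathrm{MIN}(E)$ is $E$ with the structure induced by the canonical embedding $E\subseteq C(B_{E^*})$, i.e. $\|[x_{kl}]\|_{M_n}=\sup_{f\in B_{E^*}}\|[f(x_{kl})]\|_{M_n(\mathbb C)}$, and $\mathrm{MAX}(E)$ is $E$ with $\|[x_{kl}]\|_{M_n}=\sup_u\|[u(x_{kl})]\|_{M_n(B(H_u))}$, the supremum being over all linear contractions $u\colon E\to B(H_u)$, $H_u$ a Hilbert space. -/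

import Mathlib

universe u v w

section OperatorSpaces

/-! ### Operator spaces -/

/-- The identification `M_n(B(H)) ≅ B(H^{⊕ n})`: an `n × n` matrix of bounded operators acts on the
`ℓ₂`-sum of `n` copies of `H` by `(A ξ)_i = ∑ j, A i j (ξ j)`. -/
noncomputable def matrixOperator {H : Type*} [NormedAddCommGroup H] [InnerProductSpace ℂ H]
    {n : ℕ} (A : Matrix (Fin n) (Fin n) (H →L[ℂ] H)) :
    PiLp 2 (fun _ : Fin n => H) →L[ℂ] PiLp 2 (fun _ : Fin n => H) :=
  (PiLp.continuousLinearEquiv 2 ℂ (fun _ : Fin n => H)).symm.toContinuousLinearMap ∘L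
    ContinuousLinearMap.pi fun i => ∑ j, A i j ∘L PiLp.proj 2 (fun _ : Fin n => H) j

/-- An operator space structure on a complex Banach space `V`: the family of norms on the matrix
spaces `M_n(V)` that is induced, through `M_n(V) ⊆ M_n(B(H)) ≅ B(H^{⊕ n})`, by some linear isometric
embedding of `V` into `B(H)` for some Hilbert space `H`. -/
structure OperatorSpaceStructure (V : Type u) [NormedAddCommGroup V] [NormedSpace ℂ V]
    [CompleteSpace V] where
  /-- the norm of `M_n(V)` -/
  matNorm : ∀ n : ℕ, Matrix (Fin n) (Fin n) V → ℝ
  exists_embedding : ∃ (H : Type u) (_ : NormedAddCommGroup H) (_ : InnerProductSpace ℂ H)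
    (_ : CompleteSpace H) (J : V →ₗᵢ[ℂ] (H →L[ℂ] H)),
      ∀ (n : ℕ) (x : Matrix (Fin n) (Fin n) V), matNorm n x = ‖matrixOperator (x.map J)‖

section Maps

variable {V : Type u} [NormedAddCommGroup V] [NormedSpace ℂ V] [CompleteSpace V]
  {W : Type v} [NormedAddCommGroup W] [NormedSpace ℂ W] [CompleteSpace W]

/-- A linear map is completely bounded if its amplifications `M_n(V) → M_n(W)`,
`[x_ij] ↦ [f x_ij]`, are bounded uniformly in `n`. -/
def IsCompletelyBounded (S : OperatorSpaceStructure V) (T : OperatorSpaceStructure W)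
    (f : V →ₗ[ℂ] W) : Prop :=
  ∃ K : ℝ, ∀ (n : ℕ) (x : Matrix (Fin n) (Fin n) V), T.matNorm n (x.map f) ≤ K * S.matNorm n x

/-- Two operator spaces are completely isomorphic if there is a linear bijection between them which
is completely bounded and has a completely bounded inverse. -/
def CompletelyIsomorphic (S : OperatorSpaceStructure V) (T : OperatorSpaceStructure W) : Prop :=
  ∃ e : V ≃ₗ[ℂ] W, IsCompletelyBounded S T e.toLinearMap ∧ IsCompletelyBounded T S e.symm.toLinearMap

/-- `V` completely isomorphically embeds into `W`: there is a completely bounded linear map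
`V → W` which is injective and whose inverse, defined on the range, is completely bounded. Both of
these last conditions are expressed by the lower estimate (for `n = 1` it gives injectivity). -/
def CompletelyIsomorphicallyEmbeds (S : OperatorSpaceStructure V)
    (T : OperatorSpaceStructure W) : Prop :=
  ∃ f : V →ₗ[ℂ] W, IsCompletelyBounded S T f ∧
    ∃ L : ℝ, ∀ (n : ℕ) (x : Matrix (Fin n) (Fin n) V),
      S.matNorm n x ≤ L * T.matNorm n (x.map f)

end Maps

/-! ### Facts about `matrixOperator` -/

theorem matrixOperator_apply {H : Type*} [NormedAddCommGroup H] [InnerProductSpace ℂ H]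
    {n : ℕ} (A : Matrix (Fin n) (Fin n) (H →L[ℂ] H)) (x : PiLp 2 (fun _ : Fin n => H)) (i : Fin n) :
    matrixOperator A x i = ∑ j, A i j (x j) := by
  simp [matrixOperator]

theorem norm_matrixOperator_le_sum {H : Type*} [NormedAddCommGroup H] [InnerProductSpace ℂ H]
    {n : ℕ} (A : Matrix (Fin n) (Fin n) (H →L[ℂ] H)) :
    ‖matrixOperator A‖ ≤ ∑ i, ∑ j, ‖A i j‖ := by
  refine ContinuousLinearMap.opNorm_le_bound _ (by positivity) fun x => ?_
  have h1 : ‖matrixOperator A x‖ ≤ ∑ i, ‖matrixOperator A x i‖ := by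
    rw [← sq_le_sq₀ (norm_nonneg _) (by positivity), PiLp.norm_sq_eq_of_L2]
    exact Finset.sum_sq_le_sq_sum_of_nonneg fun i _ => norm_nonneg _
  refine h1.trans ?_
  rw [Finset.sum_mul]
  refine Finset.sum_le_sum fun i _ => ?_
  rw [matrixOperator_apply, Finset.sum_mul]
  refine norm_sum_le_of_le _ fun j _ => ((A i j).le_opNorm (x j)).trans ?_
  gcongr
  exact PiLp.norm_apply_le x j

theorem norm_le_norm_matrixOperator_one {H : Type*} [NormedAddCommGroup H] [InnerProductSpace ℂ H]
    (A : Matrix (Fin 1) (Fin 1) (H →L[ℂ] H)) : ‖A 0 0‖ ≤ ‖matrixOperator A‖ := by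
  refine ContinuousLinearMap.opNorm_le_bound _ (norm_nonneg (matrixOperator A)) fun η => ?_
  have h := (matrixOperator A).le_opNorm (WithLp.toLp 2 fun _ => η)
  rw [PiLp.norm_eq_of_L2, PiLp.norm_eq_of_L2] at h
  simpa [matrixOperator_apply] using h

theorem norm_sq_lp {ι : Type*} {H : ι → Type*} [∀ i, NormedAddCommGroup (H i)]
    [∀ i, InnerProductSpace ℂ (H i)] (x : lp H 2) : HasSum (fun i => ‖x i‖ ^ 2) (‖x‖ ^ 2) := by
  have := lp.hasSum_norm (p := 2) (by simp) x
  simpa using this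

/-- A family of contractions `V → B(H_i)` which jointly compute the norm of `V` gives an isometric
embedding into `B(⊕ H_i)` by block diagonal operators, whose matrix norms are the suprema
of the matrix norms of the family. -/
theorem exists_embedding_of_family {V : Type*} [NormedAddCommGroup V] [NormedSpace ℂ V]
    {ι : Type v} {H : ι → Type w} [∀ i, NormedAddCommGroup (H i)]
    [∀ i, InnerProductSpace ℂ (H i)] [∀ i, CompleteSpace (H i)]
    (U : ∀ i, V →ₗ[ℂ] (H i →L[ℂ] H i)) (hU : ∀ i x, ‖U i x‖ ≤ ‖x‖)
    (hU' : ∀ x (C : ℝ), 0 ≤ C → (∀ i, ‖U i x‖ ≤ C) → ‖x‖ ≤ C)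
    (N : ∀ n : ℕ, Matrix (Fin n) (Fin n) V → ℝ)
    (hN : ∀ n x i, ‖matrixOperator (H := H i) (x.map fun v => U i v)‖ ≤ N n x)
    (hN' : ∀ n x (C : ℝ), 0 ≤ C → (∀ i, ‖matrixOperator (H := H i) (x.map fun v => U i v)‖ ≤ C) → N n x ≤ C)
    (hN0 : ∀ n x, 0 ≤ N n x) :
    ∃ (K : Type (max v w)) (_ : NormedAddCommGroup K) (_ : InnerProductSpace ℂ K)
    (_ : CompleteSpace K) (J : V →ₗᵢ[ℂ] (K →L[ℂ] K)),
      ∀ (n : ℕ) (x : Matrix (Fin n) (Fin n) V), N n x = ‖matrixOperator (x.map J)‖ := by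
  let J0 : V →ₗ[ℂ] (lp H 2 →L[ℂ] lp H 2) :=
    { toFun := fun x => lp.mapCLM 2 (fun i => U i x) (norm_nonneg x) (fun i => hU i x)
      map_add' := fun x y => by ext; simp
      map_smul' := fun c x => by ext; simp }
  have J0_apply : ∀ x (ξ : lp H 2) i, J0 x ξ i = U i x (ξ i) := fun x ξ i => by simp [J0]
  have hJ : ∀ x, ‖J0 x‖ = ‖x‖ := by
    intro x
    refine le_antisymm (lp.norm_mapCLM_le 2 (fun i => U i x) (norm_nonneg x) (fun i => hU i x)) ?_
    refine hU' x _ (norm_nonneg _) fun i => ?_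
    refine ContinuousLinearMap.opNorm_le_bound _ (norm_nonneg _) fun η => ?_
    classical
    have h1 := (J0 x).le_opNorm (lp.single 2 i η)
    rw [lp.norm_single (by norm_num)] at h1
    refine le_trans ?_ h1
    have h2 := lp.norm_apply_le_norm (by norm_num) (J0 x (lp.single 2 i η)) i
    rwa [J0_apply, lp.single_apply_self] at h2
  refine ⟨lp H 2, inferInstance, inferInstance, inferInstance, ⟨J0, hJ⟩, fun n x => ?_⟩
  refine le_antisymm ?_ ?_
  · refine hN' n x _ (norm_nonneg _) fun i => ?_
    refine ContinuousLinearMap.opNorm_le_bound _ (norm_nonneg _) fun η => ?_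
    classical
    set ξ : PiLp 2 (fun _ : Fin n => lp H 2) := WithLp.toLp 2 fun k => lp.single 2 i (η k) with hξ
    have hn : ‖ξ‖ = ‖η‖ := by
      rw [PiLp.norm_eq_of_L2, PiLp.norm_eq_of_L2]
      simp [hξ, lp.norm_single]
    rw [← hn]
    refine le_trans ?_ (ContinuousLinearMap.le_opNorm _ ξ)
    rw [← sq_le_sq₀ (norm_nonneg _) (norm_nonneg _), PiLp.norm_sq_eq_of_L2, PiLp.norm_sq_eq_of_L2]
    refine Finset.sum_le_sum fun k _ => ?_
    gcongr
    have h2 := lp.norm_apply_le_norm (by norm_num)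
      (matrixOperator (x.map (⟨J0, hJ⟩ : V →ₗᵢ[ℂ] (lp H 2 →L[ℂ] lp H 2))) ξ k) i
    refine le_trans (le_of_eq ?_) h2
    rw [matrixOperator_apply, matrixOperator_apply, lp.coeFn_sum, Finset.sum_apply]
    congr 1
    refine Finset.sum_congr rfl fun l _ => ?_
    simp [J0_apply, hξ]
  · refine ContinuousLinearMap.opNorm_le_bound _ (hN0 n x) fun ξ => ?_
    rw [← sq_le_sq₀ (norm_nonneg _) (mul_nonneg (hN0 n x) (norm_nonneg _)), mul_pow,
      PiLp.norm_sq_eq_of_L2, PiLp.norm_sq_eq_of_L2]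
    let ξi : ∀ i, PiLp 2 (fun _ : Fin n => H i) := fun i => WithLp.toLp 2 fun k => ξ k i
    have h1 := hasSum_sum (s := Finset.univ) fun k (_ : k ∈ Finset.univ) => norm_sq_lp
      (matrixOperator (x.map (⟨J0, hJ⟩ : V →ₗᵢ[ℂ] (lp H 2 →L[ℂ] lp H 2))) ξ k)
    have h2 := (hasSum_sum (s := Finset.univ) fun k (_ : k ∈ Finset.univ) =>
      norm_sq_lp (ξ k)).mul_left ((N n x) ^ 2)
    refine hasSum_le (fun i => ?_) h1 h2
    have h3 := (matrixOperator (x.map fun v => U i v)).le_of_opNorm_le (hN n x i) (ξi i)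
    rw [← sq_le_sq₀ (norm_nonneg _) (mul_nonneg (hN0 n x) (norm_nonneg _)), mul_pow,
      PiLp.norm_sq_eq_of_L2, PiLp.norm_sq_eq_of_L2] at h3
    refine le_trans (le_of_eq ?_) h3
    refine Finset.sum_congr rfl fun k _ => ?_
    rw [matrixOperator_apply, matrixOperator_apply, lp.coeFn_sum, Finset.sum_apply]
    simp [J0_apply, ξi]


section Basic

variable {V : Type u} [NormedAddCommGroup V] [NormedSpace ℂ V] [CompleteSpace V]

theorem OperatorSpaceStructure.matNorm_nonneg (S : OperatorSpaceStructure V) (n : ℕ)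
    (x : Matrix (Fin n) (Fin n) V) : 0 ≤ S.matNorm n x := by
  obtain ⟨H, _, _, _, J, hJ⟩ := S.exists_embedding
  rw [hJ]
  exact norm_nonneg _

theorem OperatorSpaceStructure.matNorm_le_sum (S : OperatorSpaceStructure V) (n : ℕ)
    (x : Matrix (Fin n) (Fin n) V) : S.matNorm n x ≤ ∑ i, ∑ j, ‖x i j‖ := by
  obtain ⟨H, _, _, _, J, hJ⟩ := S.exists_embedding
  rw [hJ]
  exact (norm_matrixOperator_le_sum _).trans_eq (by simp)

end Basic

/-! ### Subspaces of `B(H)` and finite intersections -/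

/-- The operator space structure induced on a closed subspace of `B(H)` by the inclusion. -/
noncomputable def OperatorSpaceStructure.ofSubspace {H : Type u} [NormedAddCommGroup H]
    [InnerProductSpace ℂ H] [CompleteSpace H] (E : Submodule ℂ (H →L[ℂ] H)) [CompleteSpace E] :
    OperatorSpaceStructure E where
  matNorm n x := ‖matrixOperator (x.map fun v => (v : H →L[ℂ] H))‖
  exists_embedding := ⟨H, inferInstance, inferInstance, inferInstance, E.subtypeₗᵢ, fun _ _ => rfl⟩

/-! ### `c₀`-sums -/

section CZeroSum

variable (V : ℕ → Type u) [∀ i, NormedAddCommGroup (V i)] [∀ i, NormedSpace ℂ (V i)]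

/-- The `c₀`-sum of a sequence of normed spaces: the bounded sequences `(x_i)` with `‖x_i‖ → 0`, as
a subspace of the `ℓ_∞`-sum, so with norm `sup_i ‖x_i‖`. -/
def cZeroSum : Submodule ℂ (lp V ⊤) where
  carrier := {x | Filter.Tendsto (fun i => ‖x i‖) Filter.atTop (nhds 0)}
  add_mem' {x y} hx hy := by
    refine squeeze_zero (fun i => norm_nonneg _) (fun i => norm_add_le (x i) (y i)) ?_
    simpa using Filter.Tendsto.add hx hy
  zero_mem' := by simp
  smul_mem' c x hx := by
    have := Filter.Tendsto.const_mul ‖c‖ hx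
    simpa [norm_smul] using this

theorem isClosed_cZeroSum : IsClosed (cZeroSum V : Set (lp V ⊤)) := by
  refine isClosed_of_closure_subset fun x hx => ?_
  rw [Metric.mem_closure_iff] at hx
  refine Metric.tendsto_atTop.2 fun ε hε => ?_
  obtain ⟨y, hy, hxy⟩ := hx (ε / 2) (by positivity)
  obtain ⟨N, hN⟩ := Metric.tendsto_atTop.1 hy (ε / 2) (by positivity)
  refine ⟨N, fun i hi => ?_⟩
  have h1 := hN i hi
  have h2 := lp.norm_apply_le_norm (by simp) (x - y) i
  rw [dist_eq_norm] at hxy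
  simp only [dist_zero_right, norm_norm] at h1 ⊢
  have h3 : ‖x i‖ ≤ ‖(x - y : lp V ⊤) i‖ + ‖y i‖ := by
    have := norm_add_le ((x - y : lp V ⊤) i) (y i)
    simpa using this
  linarith

instance [∀ i, CompleteSpace (V i)] : CompleteSpace (cZeroSum V) :=
  (isClosed_cZeroSum V).completeSpace_coe

variable {V} [∀ i, CompleteSpace (V i)]

/-- The `c₀`-sum of a sequence of operator spaces:
`‖[x_kl]‖_{M_n} = sup_i ‖[x_kl(i)]‖_{M_n(V_i)}`. -/
noncomputable def OperatorSpaceStructure.cZeroSum (S : ∀ i, OperatorSpaceStructure (V i)) :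
    OperatorSpaceStructure (cZeroSum V) where
  matNorm n x := ⨆ i, (S i).matNorm n (x.map fun v => (v : lp V ⊤) i)
  exists_embedding := by
    choose H h1 h2 h3 J hJ using fun i => (S i).exists_embedding
    have key : ∀ n (x : Matrix (Fin n) (Fin n) (_root_.cZeroSum V)) i,
        ‖matrixOperator (H := H i) (x.map fun v => J i ((v : lp V ⊤) i))‖ =
          (S i).matNorm n (x.map fun v => (v : lp V ⊤) i) := fun n x i => (hJ i n _).symm
    have bdd : ∀ n (x : Matrix (Fin n) (Fin n) (_root_.cZeroSum V)),
        BddAbove (Set.range fun i => (S i).matNorm n (x.map fun v => (v : lp V ⊤) i)) := by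
      intro n x
      refine ⟨∑ k, ∑ l, ‖x k l‖, ?_⟩
      rintro _ ⟨i, rfl⟩
      refine ((S i).matNorm_le_sum n _).trans ?_
      gcongr with k _ l _
      exact lp.norm_apply_le_norm (by simp) (x k l : lp V ⊤) i
    refine exists_embedding_of_family (H := H)
      (fun i => (J i).toLinearMap ∘ₗ
        { toFun := fun v : _root_.cZeroSum V => (v : lp V ⊤) i
          map_add' := fun _ _ => rfl
          map_smul' := fun _ _ => rfl }) ?_ ?_ _ ?_ ?_ ?_
    · intro i x
      exact ((J i).norm_map _).trans_le (lp.norm_apply_le_norm (by simp) (x : lp V ⊤) i)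
    · intro x C hC h
      exact lp.norm_le_of_forall_le hC fun i => ((J i).norm_map _).symm.trans_le (h i)
    · intro n x i
      exact (key n x i).trans_le (le_ciSup (bdd n x) i)
    · intro n x C hC h
      exact ciSup_le fun i => (key n x i).symm.trans_le (h i)
    · exact fun n x => Real.iSup_nonneg fun i => (S i).matNorm_nonneg n _

end CZeroSum

/-! ### Minimal and maximal operator spaces -/

section MinMax

variable (V : Type u) [NormedAddCommGroup V] [NormedSpace ℂ V] [CompleteSpace V]

/-- `MIN(V)`: the structure induced by `V ⊆ C(B_{V*})`, `v ↦ (f ↦ f v)`. The norm of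
`M_n(C(B_{V*})) = C(B_{V*}, M_n(ℂ))` is the supremum over `f` in the closed unit ball `B_{V*}` of the
norm of the scalar matrix `[f x_ij]` as an operator on the Hilbert space `ℂ^n`. -/
noncomputable def OperatorSpaceStructure.MIN : OperatorSpaceStructure V where
  matNorm n x := ⨆ f : Metric.closedBall (0 : StrongDual ℂ V) 1,
    ‖Matrix.toEuclideanCLM (n := Fin n) (𝕜 := ℂ) (x.map fun v => (f : StrongDual ℂ V) v)‖
  exists_embedding := by
    have key : ∀ n (x : Matrix (Fin n) (Fin n) V) (f : StrongDual ℂ V),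
        ‖matrixOperator (x.map fun v => f v • ContinuousLinearMap.id ℂ ℂ)‖ =
          ‖Matrix.toEuclideanCLM (n := Fin n) (𝕜 := ℂ) (x.map fun v => f v)‖ := by
      intro n x f
      have : (matrixOperator (x.map fun v => f v • ContinuousLinearMap.id ℂ ℂ) :
          EuclideanSpace ℂ (Fin n) →L[ℂ] EuclideanSpace ℂ (Fin n)) =
          Matrix.toEuclideanCLM (n := Fin n) (𝕜 := ℂ) (x.map fun v => f v) := by
        ext ξ i
        rw [matrixOperator_apply, Matrix.ofLp_toEuclideanCLM]
        simp [Matrix.mulVec, dotProduct]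
      exact congrArg norm this
    have hf : ∀ (f : Metric.closedBall (0 : StrongDual ℂ V) 1) (v : V),
        ‖(f : StrongDual ℂ V) v‖ ≤ ‖v‖ := fun f v => by
      have := (f : StrongDual ℂ V).le_of_opNorm_le (mem_closedBall_zero_iff.1 f.2) v
      simpa using this
    have bdd : ∀ n (x : Matrix (Fin n) (Fin n) V),
        BddAbove (Set.range fun f : Metric.closedBall (0 : StrongDual ℂ V) 1 =>
          ‖Matrix.toEuclideanCLM (n := Fin n) (𝕜 := ℂ)
            (x.map fun v => (f : StrongDual ℂ V) v)‖) := by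
      intro n x
      refine ⟨∑ k, ∑ l, ‖x k l‖, ?_⟩
      rintro _ ⟨f, rfl⟩
      dsimp only
      rw [← key]
      refine (norm_matrixOperator_le_sum _).trans ?_
      gcongr with k _ l _
      simpa [norm_smul] using hf f (x k l)
    refine exists_embedding_of_family (ι := Metric.closedBall (0 : StrongDual ℂ V) 1)
      (H := fun _ => ℂ)
      (fun f => (LinearMap.toSpanSingleton ℂ (ℂ →L[ℂ] ℂ) (ContinuousLinearMap.id ℂ ℂ)) ∘ₗ
        (f : StrongDual ℂ V).toLinearMap) ?_ ?_ _ ?_ ?_ ?_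
    · intro f v
      simpa [norm_smul] using hf f v
    · intro v C hC h
      obtain ⟨g, hg, hgv⟩ := exists_dual_vector'' ℂ v
      have := h ⟨g, mem_closedBall_zero_iff.2 hg⟩
      simpa [norm_smul, hgv] using this
    · intro n x f
      exact (key n x f).trans_le (le_ciSup (bdd n x) f)
    · intro n x C hC h
      have : Nonempty (Metric.closedBall (0 : StrongDual ℂ V) 1) := ⟨⟨0, by simp⟩⟩
      exact ciSup_le fun f => (key n x f).symm.trans_le (h f)
    · exact fun n x => Real.iSup_nonneg fun f => norm_nonneg _

/-- The values `‖[u x_ij]‖`, for `u : V → B(H)` a linear contraction and `H` a Hilbert space. -/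
def maxNormSet {V : Type u} [NormedAddCommGroup V] [NormedSpace ℂ V] {n : ℕ}
    (x : Matrix (Fin n) (Fin n) V) : Set ℝ :=
  {t | ∃ (H : Type u) (_ : NormedAddCommGroup H) (_ : InnerProductSpace ℂ H) (_ : CompleteSpace H)
    (u : V →L[ℂ] (H →L[ℂ] H)), ‖u‖ ≤ 1 ∧ t = ‖matrixOperator (x.map u)‖}

/-- `MAX(V)`: the structure induced by the embedding `v ↦ (u v)_u` into the `ℓ_∞`-sum of the
`B(H_u)`, over all linear contractions `u : V → B(H_u)` with `H_u` a Hilbert space. -/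
noncomputable def OperatorSpaceStructure.MAX : OperatorSpaceStructure V where
  matNorm n x := sSup (maxNormSet x)
  exists_embedding := by
    have bdd : ∀ n (x : Matrix (Fin n) (Fin n) V), BddAbove (maxNormSet x) := by
      intro n x
      refine ⟨∑ k, ∑ l, ‖x k l‖, ?_⟩
      rintro _ ⟨H, _, _, _, u, hu, rfl⟩
      refine (norm_matrixOperator_le_sum _).trans ?_
      gcongr with k _ l _
      simpa using u.le_of_opNorm_le hu (x k l)
    obtain ⟨H0, _, _, _, J, -⟩ := (OperatorSpaceStructure.MIN V).exists_embedding
    have hJ : ‖J.toContinuousLinearMap‖ ≤ 1 := J.norm_toContinuousLinearMap_le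
    have nonempty : ∀ n (x : Matrix (Fin n) (Fin n) V), (maxNormSet x).Nonempty := fun n x =>
      ⟨_, H0, _, _, inferInstance, J.toContinuousLinearMap, hJ, rfl⟩
    -- countably many contractions for every matrix compute its norm
    have approx : ∀ i : (Σ n : ℕ, Matrix (Fin n) (Fin n) V) × ℕ,
        ∃ t ∈ maxNormSet i.1.2, sSup (maxNormSet i.1.2) - 1 / ((i.2 : ℝ) + 1) < t := fun i =>
      exists_lt_of_lt_csSup (nonempty _ _) (sub_lt_self _ (by positivity))
    choose t ht htlt using approx
    choose H h1 h2 h3 U hU hUt using ht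
    have mem : ∀ n (x : Matrix (Fin n) (Fin n) V) i,
        ‖matrixOperator (H := H i) (x.map fun v => U i v)‖ ∈ maxNormSet x := fun n x i =>
      ⟨H i, h1 i, h2 i, h3 i, U i, hU i, rfl⟩
    have approx_le : ∀ n (x : Matrix (Fin n) (Fin n) V) (C : ℝ),
        (∀ i, ‖matrixOperator (H := H i) (x.map fun v => U i v)‖ ≤ C) →
          sSup (maxNormSet x) ≤ C := by
      intro n x C h
      refine le_of_forall_pos_lt_add fun ε hε => ?_
      obtain ⟨m, hm⟩ := exists_nat_one_div_lt hε
      have e1 := htlt ⟨⟨n, x⟩, m⟩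
      have e2 := h ⟨⟨n, x⟩, m⟩
      have e3 := hUt ⟨⟨n, x⟩, m⟩
      dsimp only at e1 e3
      have e4 := e3.trans_le e2
      linarith
    refine exists_embedding_of_family (ι := (Σ n : ℕ, Matrix (Fin n) (Fin n) V) × ℕ) (H := H)
      (fun i => (U i).toLinearMap) ?_ ?_ _ ?_ ?_ ?_
    · intro i v
      simpa using (U i).le_of_opNorm_le (hU i) v
    · intro v C hC h
      let x : Matrix (Fin 1) (Fin 1) V := fun _ _ => v
      have e1 : ‖v‖ ≤ sSup (maxNormSet x) := by
        refine le_trans ?_ (le_csSup (bdd 1 x)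
          ⟨H0, _, _, inferInstance, J.toContinuousLinearMap, hJ, rfl⟩)
        refine le_trans ?_ (norm_le_norm_matrixOperator_one _)
        exact (J.norm_map v).ge
      refine e1.trans (approx_le 1 x C fun i => ?_)
      refine (norm_matrixOperator_le_sum _).trans ?_
      rw [Fin.sum_univ_one, Fin.sum_univ_one]
      exact h i
    · exact fun n x i => le_csSup (bdd n x) (mem n x i)
    · exact fun n x C hC h => approx_le n x C h
    · intro n x
      obtain ⟨t, ht⟩ := nonempty n x
      refine le_trans ?_ (le_csSup (bdd n x) ht)
      obtain ⟨H, _, _, _, u, hu, rfl⟩ := ht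
      exact norm_nonneg _

end MinMax

/-! ### Row and column operator spaces -/

section RowColumn

/-- The Hilbert space `ℓ₂` of square summable complex sequences (indexed from `0`). -/
abbrev EllTwo : Type := lp (fun _ : ℕ => ℂ) 2

/-- The canonical orthonormal basis of `ℓ₂`. -/
noncomputable def ellTwoBasis (i : ℕ) : EllTwo := lp.single 2 i 1

/-- The matrix unit `e_ij ∈ B(ℓ₂)`, `ξ ↦ ⟪e_j, ξ⟫ e_i`: it maps `e_j` to `e_i`, and `e_k` to `0` for
`k ≠ j`. -/
noncomputable def matrixUnit (i j : ℕ) : EllTwo →L[ℂ] EllTwo :=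
  InnerProductSpace.rankOne ℂ (ellTwoBasis i) (ellTwoBasis j)

theorem matrixUnit_apply_basis (i j k : ℕ) :
    matrixUnit i j (ellTwoBasis k) = if k = j then ellTwoBasis i else 0 := by
  rw [matrixUnit, InnerProductSpace.rankOne_apply, ellTwoBasis, ellTwoBasis, lp.inner_single_left]
  split_ifs with h
  · subst h
    simp
  · rw [lp.single_apply_ne _ _ _ (Ne.symm h)]
    simp

/-- The row space: the closed linear span in `B(ℓ₂)` of the matrix units of the first row. -/
noncomputable abbrev rowSubspace : Submodule ℂ (EllTwo →L[ℂ] EllTwo) :=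
  (Submodule.span ℂ (Set.range fun i => matrixUnit 0 i)).topologicalClosure

/-- The column space: the closed linear span in `B(ℓ₂)` of the matrix units of the first column. -/
noncomputable abbrev columnSubspace : Submodule ℂ (EllTwo →L[ℂ] EllTwo) :=
  (Submodule.span ℂ (Set.range fun i => matrixUnit i 0)).topologicalClosure

/-- The row operator space `R`. -/
noncomputable def OperatorSpaceStructure.row : OperatorSpaceStructure rowSubspace :=
  OperatorSpaceStructure.ofSubspace rowSubspace

/-- The column operator space `C`. -/
noncomputable def OperatorSpaceStructure.column : OperatorSpaceStructure columnSubspace :=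
  OperatorSpaceStructure.ofSubspace columnSubspace

/-- A continuous linear map on `ℓ₂` takes its values in any closed subspace that contains the images
of the basis vectors. -/
theorem mem_of_forall_basis_mem {W : Type*} [NormedAddCommGroup W] [NormedSpace ℂ W]
    (f : EllTwo →L[ℂ] W) (E : Submodule ℂ W) (hE : IsClosed (E : Set W))
    (h : ∀ i, f (ellTwoBasis i) ∈ E) (x : EllTwo) : f x ∈ E := by
  have h1 := (lp.hasSum_single (p := 2) (by simp) x).mapL f
  refine hE.mem_of_tendsto h1 (Filter.Eventually.of_forall fun s => E.sum_mem fun i _ => ?_)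
  have h2 : (lp.single 2 i (x i) : EllTwo) = x i • ellTwoBasis i := by
    rw [ellTwoBasis, ← lp.single_smul, smul_eq_mul, mul_one]
  rw [h2, map_smul]
  exact E.smul_mem _ (h i)

/-- `x ↦ ∑ x_i e_1i`, as a map into `B(ℓ₂)`: the operator `ξ ↦ ⟪conj x, ξ⟫ e_1`. -/
noncomputable def rowOperator : EllTwo →ₗᵢ[ℂ] (EllTwo →L[ℂ] EllTwo) where
  toFun x := InnerProductSpace.rankOne ℂ (ellTwoBasis 0) (star x)
  map_add' x y := by simp
  map_smul' c x := by simp [star_smul]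
  norm_map' x := by
    change ‖InnerProductSpace.rankOne ℂ (ellTwoBasis 0) (star x)‖ = ‖x‖
    rw [InnerProductSpace.norm_rankOne, norm_star, ellTwoBasis, lp.norm_single (by norm_num)]
    simp

/-- `x ↦ ∑ x_i e_i1`, as a map into `B(ℓ₂)`: the operator `ξ ↦ ⟪e_1, ξ⟫ x`. -/
noncomputable def columnOperator : EllTwo →ₗᵢ[ℂ] (EllTwo →L[ℂ] EllTwo) where
  toFun x := InnerProductSpace.rankOne ℂ x (ellTwoBasis 0)
  map_add' x y := by simp
  map_smul' c x := by simp
  norm_map' x := by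
    change ‖InnerProductSpace.rankOne ℂ x (ellTwoBasis 0)‖ = ‖x‖
    rw [InnerProductSpace.norm_rankOne, ellTwoBasis, lp.norm_single (by norm_num)]
    simp

theorem rowOperator_basis (i : ℕ) : rowOperator (ellTwoBasis i) = matrixUnit 0 i := by
  have h : star (ellTwoBasis i) = ellTwoBasis i := by
    ext k
    rw [lp.star_apply, ellTwoBasis, lp.single_apply]
    by_cases hk : k = i <;> simp [hk]
  change InnerProductSpace.rankOne ℂ (ellTwoBasis 0) (star (ellTwoBasis i)) = _
  rw [h, matrixUnit]

theorem columnOperator_basis (i : ℕ) : columnOperator (ellTwoBasis i) = matrixUnit i 0 := rfl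

/-- The isometry `r : ℓ₂ → R`, `r(e_i) = e_1i`. -/
noncomputable def rowIsometry : EllTwo →ₗᵢ[ℂ] rowSubspace where
  toLinearMap := rowOperator.toLinearMap.codRestrict rowSubspace <|
    mem_of_forall_basis_mem rowOperator.toContinuousLinearMap _
      (Submodule.isClosed_topologicalClosure _) fun i =>
        Submodule.le_topologicalClosure _ (Submodule.subset_span ⟨i, (rowOperator_basis i).symm⟩)
  norm_map' x := rowOperator.norm_map x

/-- The isometry `c : ℓ₂ → C`, `c(e_i) = e_i1`. -/
noncomputable def columnIsometry : EllTwo →ₗᵢ[ℂ] columnSubspace where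
  toLinearMap := columnOperator.toLinearMap.codRestrict columnSubspace <|
    mem_of_forall_basis_mem columnOperator.toContinuousLinearMap _
      (Submodule.isClosed_topologicalClosure _) fun i =>
        Submodule.le_topologicalClosure _ (Submodule.subset_span ⟨i, (columnOperator_basis i).symm⟩)
  norm_map' x := columnOperator.norm_map x

/-- `R ∩ C`: the Banach space `ℓ₂` with the structure induced by `x ↦ (r x, c x) ∈ R ⊕_∞ C`. -/
noncomputable def OperatorSpaceStructure.rowInterColumn : OperatorSpaceStructure EllTwo where
  matNorm n x := max (OperatorSpaceStructure.row.matNorm n (x.map rowIsometry))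
    (OperatorSpaceStructure.column.matNorm n (x.map columnIsometry))
  exists_embedding := by
    refine exists_embedding_of_family (ι := Bool) (H := fun _ => EllTwo)
      (fun b => cond b rowOperator.toLinearMap columnOperator.toLinearMap) ?_ ?_ _ ?_ ?_ ?_
    · rintro (_ | _) x
      · exact (columnOperator.norm_map x).le
      · exact (rowOperator.norm_map x).le
    · intro x C _ h
      exact (rowOperator.norm_map x).symm.trans_le (h true)
    · rintro n x (_ | _)
      · exact le_max_right _ _
      · exact le_max_left _ _
    · intro n x C _ h
      exact max_le (h true) (h false)
    · intro n x
      exact le_max_of_le_left (norm_nonneg _)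

end RowColumn

end OperatorSpaces

/-! ### Rows and columns of weighted vectors. -/

section LineMatrix

/-! Test vectors are lines: the row, or the column, of the weighted basis vectors `t k • e k`. In
`R` a row of this kind has norm at least `‖t‖₂`; in `C` a column does; `R ∩ C` and `MAX(ℓ₂)`
dominate `R` and inherit the row estimate. If `f` were a complete embedding into the `c₀`-sum, with
coordinates `F i : ℓ₂ → Y i`, then `‖t‖₂` would be at most a constant times the supremum over `i` of
the norm of the line of the `t k • F i (e k)`. So it suffices to find weights with `‖t‖₂`
arbitrarily large for which these suprema stay bounded.

Three estimates make this possible. The Frobenius bound gives at most `K ‖t‖₂` in every `Y i`, where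
`K` bounds `f` (`OperatorSpaceStructure.matNorm_lineMatrix_sq_le`). In `MIN(ℓ₂)`, Bessel's
inequality bounds the line by a multiple of `sup |t k|`, so in `Y i` it is at most `C i * sup |t k|`
(`matNorm_MIN_lineMatrix_le`). For fixed finitely supported `t` the norm in `Y i` tends to `0` as `i
→ ∞`, since each `(F i (e k))_i` lies in the `c₀`-sum.

A gliding hump combines them (`exists_weights_of_gliding_hump`): add disjoint blocks of unit
`ℓ₂`-norm, each so flat that it is negligible in the finitely many coordinates where the earlier
blocks are not. No coordinate collects more than one contribution of size `K`, and each step meets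
only finitely many `C i`, so these need no uniform bound. -/

/-- The square matrix whose first row (for `b = true`) or first column (for `b = false`) has the
entries `t k • w k`, and whose other entries vanish. -/
noncomputable def lineMatrix {V : Type*} [AddCommGroup V] [Module ℂ V] (b : Bool) (n : ℕ)
    (t : ℕ → ℝ) (w : ℕ → V) : Matrix (Fin n) (Fin n) V := fun i j =>
  match b with
  | true => if (i : ℕ) = 0 then (t j : ℂ) • w j else 0
  | false => if (j : ℕ) = 0 then (t i : ℂ) • w i else 0

variable {V : Type*} [AddCommGroup V] [Module ℂ V] {W : Type*} [AddCommGroup W] [Module ℂ W]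

theorem lineMatrix_map (b : Bool) (n : ℕ) (t : ℕ → ℝ) (w : ℕ → V) (f : V →ₗ[ℂ] W) :
    (lineMatrix b n t w).map f = lineMatrix b n t fun k => f (w k) := by
  ext i j
  cases b <;> simp only [lineMatrix, Matrix.map_apply] <;> split_ifs <;> simp

theorem lineMatrix_add (b : Bool) (n : ℕ) (s t : ℕ → ℝ) (w : ℕ → V) :
    lineMatrix b n (s + t) w = lineMatrix b n s w + lineMatrix b n t w := by
  ext i j
  cases b <;> simp only [lineMatrix, Matrix.add_apply] <;> split_ifs <;> simp [add_smul]

theorem sum_line_le (n : ℕ) (a : ℕ → ℝ) :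
    ∑ i : Fin n, ∑ j : Fin n, (if (i : ℕ) = 0 then a j else 0) ≤ ∑ k ∈ Finset.range n, a k := by
  rw [Finset.sum_range]
  rcases n with _ | n
  · simp
  · rw [Fin.sum_univ_succ]
    simp

theorem sum_norm_sq_lineMatrix_le {V : Type*} [NormedAddCommGroup V] [NormedSpace ℂ V]
    (b : Bool) (n : ℕ) (t : ℕ → ℝ) (w : ℕ → V) :
    ∑ i, ∑ j, ‖lineMatrix b n t w i j‖ ^ 2 ≤ ∑ k ∈ Finset.range n, t k ^ 2 * ‖w k‖ ^ 2 := by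
  have h := sum_line_le n fun k => t k ^ 2 * ‖w k‖ ^ 2
  refine le_trans (le_of_eq ?_) h
  cases b
  · rw [Finset.sum_comm]
    refine Finset.sum_congr rfl fun i _ => Finset.sum_congr rfl fun j _ => ?_
    simp only [lineMatrix]
    split_ifs <;> simp [norm_smul, mul_pow]
  · refine Finset.sum_congr rfl fun i _ => Finset.sum_congr rfl fun j _ => ?_
    simp only [lineMatrix]
    split_ifs <;> simp [norm_smul, mul_pow]

end LineMatrix

/-! ### Frobenius bounds and basic properties of the matrix norms. -/

section NormBounds

/-- The operator norm of a matrix of operators is at most its Frobenius norm. -/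
theorem norm_matrixOperator_sq_le {H : Type*} [NormedAddCommGroup H] [InnerProductSpace ℂ H]
    {n : ℕ} (A : Matrix (Fin n) (Fin n) (H →L[ℂ] H)) :
    ‖matrixOperator A‖ ^ 2 ≤ ∑ i, ∑ j, ‖A i j‖ ^ 2 := by
  have hs : 0 ≤ ∑ i, ∑ j, ‖A i j‖ ^ 2 := by positivity
  refine (Real.le_sqrt (norm_nonneg (matrixOperator A)) hs).1 ?_
  refine ContinuousLinearMap.opNorm_le_bound _ (Real.sqrt_nonneg _) fun x => ?_
  rw [← sq_le_sq₀ (norm_nonneg _) (by positivity), mul_pow, Real.sq_sqrt hs,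
    PiLp.norm_sq_eq_of_L2, PiLp.norm_sq_eq_of_L2, Finset.sum_mul]
  refine Finset.sum_le_sum fun i _ => ?_
  refine le_trans ?_ (Finset.sum_mul_sq_le_sq_mul_sq Finset.univ (fun j => ‖A i j‖) fun j => ‖x j‖)
  gcongr
  rw [matrixOperator_apply]
  exact norm_sum_le_of_le _ fun j _ => (A i j).le_opNorm (x j)

/-- Scalars are operators on the Hilbert space `ℂ`, so this is a case of the operator-valued bound.
-/
theorem norm_toEuclideanCLM_sq_le {n : ℕ} (A : Matrix (Fin n) (Fin n) ℂ) :
    ‖Matrix.toEuclideanCLM (n := Fin n) (𝕜 := ℂ) A‖ ^ 2 ≤ ∑ i, ∑ j, ‖A i j‖ ^ 2 := by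
  have h := norm_matrixOperator_sq_le (A.map fun z => z • ContinuousLinearMap.id ℂ ℂ)
  have e : (matrixOperator (A.map fun z => z • ContinuousLinearMap.id ℂ ℂ) :
      EuclideanSpace ℂ (Fin n) →L[ℂ] EuclideanSpace ℂ (Fin n)) =
      Matrix.toEuclideanCLM (n := Fin n) (𝕜 := ℂ) A := by
    ext ξ i
    rw [matrixOperator_apply, Matrix.ofLp_toEuclideanCLM]
    simp [Matrix.mulVec, dotProduct]
  have e' : ‖Matrix.toEuclideanCLM (n := Fin n) (𝕜 := ℂ) A‖ =
      ‖matrixOperator (A.map fun z => z • ContinuousLinearMap.id ℂ ℂ)‖ := (congrArg norm e).symm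
  rw [e']
  simpa [norm_smul] using h

theorem matrixOperator_add {H : Type*} [NormedAddCommGroup H] [InnerProductSpace ℂ H]
    {n : ℕ} (A B : Matrix (Fin n) (Fin n) (H →L[ℂ] H)) :
    matrixOperator (A + B) = matrixOperator A + matrixOperator B := by
  ext x i
  rw [add_apply, PiLp.add_apply, matrixOperator_apply, matrixOperator_apply,
    matrixOperator_apply]
  simp [Finset.sum_add_distrib]

variable {V : Type u} [NormedAddCommGroup V] [NormedSpace ℂ V] [CompleteSpace V]
  {W : Type v} [NormedAddCommGroup W] [NormedSpace ℂ W] [CompleteSpace W]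

theorem OperatorSpaceStructure.matNorm_sq_le (S : OperatorSpaceStructure V) (n : ℕ)
    (x : Matrix (Fin n) (Fin n) V) : S.matNorm n x ^ 2 ≤ ∑ i, ∑ j, ‖x i j‖ ^ 2 := by
  obtain ⟨H, _, _, _, J, hJ⟩ := S.exists_embedding
  rw [hJ]
  exact (norm_matrixOperator_sq_le _).trans_eq (by simp)

theorem OperatorSpaceStructure.matNorm_add_le (S : OperatorSpaceStructure V) (n : ℕ)
    (x y : Matrix (Fin n) (Fin n) V) : S.matNorm n (x + y) ≤ S.matNorm n x + S.matNorm n y := by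
  obtain ⟨H, _, _, _, J, hJ⟩ := S.exists_embedding
  rw [hJ, hJ, hJ, Matrix.map_add _ (map_add J), matrixOperator_add]
  exact norm_add_le _ _

theorem OperatorSpaceStructure.matNorm_one (S : OperatorSpaceStructure V) (v : V) :
    S.matNorm 1 (Matrix.of fun _ _ => v) = ‖v‖ := by
  refine le_antisymm ((S.matNorm_le_sum 1 _).trans_eq (by simp)) ?_
  obtain ⟨H, _, _, _, J, hJ⟩ := S.exists_embedding
  rw [hJ, ← J.norm_map v]
  exact norm_le_norm_matrixOperator_one ((Matrix.of fun _ _ => v).map J)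

theorem OperatorSpaceStructure.matNorm_lineMatrix_sq_le (S : OperatorSpaceStructure V)
    (b : Bool) (n : ℕ) (t : ℕ → ℝ) (w : ℕ → V) :
    S.matNorm n (lineMatrix b n t w) ^ 2 ≤ ∑ k ∈ Finset.range n, t k ^ 2 * ‖w k‖ ^ 2 :=
  (S.matNorm_sq_le n _).trans (sum_norm_sq_lineMatrix_le b n t w)

/-- Level `n = 1` of complete boundedness. The constant there may be negative, hence the absolute
value. -/
theorem IsCompletelyBounded.exists_norm_le {S : OperatorSpaceStructure V}
    {T : OperatorSpaceStructure W} {f : V →ₗ[ℂ] W} (hf : IsCompletelyBounded S T f) :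
    ∃ K : ℝ, 0 ≤ K ∧ ∀ v, ‖f v‖ ≤ K * ‖v‖ := by
  obtain ⟨K, hK⟩ := hf
  refine ⟨|K|, abs_nonneg K, fun v => ?_⟩
  rw [← S.matNorm_one v, ← T.matNorm_one (f v)]
  exact (hK 1 (Matrix.of fun _ _ => v)).trans
    (mul_le_mul_of_nonneg_right (le_abs_self K) (S.matNorm_nonneg _ _))

end NormBounds

/-! ### Bessel's inequality and lines in minimal spaces. -/

section EllTwo

theorem orthonormal_ellTwoBasis : Orthonormal ℂ ellTwoBasis := by
  rw [orthonormal_iff_ite]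
  intro i j
  rw [ellTwoBasis, ellTwoBasis, lp.inner_single_left]
  by_cases h : i = j
  · subst h
    simp
  · rw [if_neg h, lp.single_apply_ne _ _ _ h]
    simp

theorem norm_ellTwoBasis (k : ℕ) : ‖ellTwoBasis k‖ = 1 := orthonormal_ellTwoBasis.1 k

/-- Bessel's inequality for the vector that represents `h` by the Riesz theorem. -/
theorem sum_norm_sq_dual_ellTwoBasis_le (h : StrongDual ℂ EllTwo) (s : Finset ℕ) :
    ∑ k ∈ s, ‖h (ellTwoBasis k)‖ ^ 2 ≤ ‖h‖ ^ 2 := by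
  have e := orthonormal_ellTwoBasis.sum_inner_products_le
    ((InnerProductSpace.toDual ℂ EllTwo).symm h) (s := s)
  rw [LinearIsometryEquiv.norm_map] at e
  refine le_trans (le_of_eq (Finset.sum_congr rfl fun k _ => ?_)) e
  rw [← InnerProductSpace.toDual_symm_apply (x := ellTwoBasis k) (y := h), norm_inner_symm]

/-- In the minimal structure, the norm of the row or column of the vectors `t k • T (e k)` is
controlled by the supremum of the weights. -/
theorem matNorm_MIN_lineMatrix_le {W : Type u} [NormedAddCommGroup W] [NormedSpace ℂ W]
    [CompleteSpace W] (T : EllTwo →L[ℂ] W) (b : Bool) (n : ℕ) (t : ℕ → ℝ) {δ : ℝ} (hδ : 0 ≤ δ)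
    (ht : ∀ k, |t k| ≤ δ) :
    (OperatorSpaceStructure.MIN W).matNorm n (lineMatrix b n t fun k => T (ellTwoBasis k)) ≤
      ‖T‖ * δ := by
  have : Nonempty (Metric.closedBall (0 : StrongDual ℂ W) 1) := ⟨⟨0, by simp⟩⟩
  refine ciSup_le fun g => ?_
  rw [← sq_le_sq₀ (norm_nonneg _) (by positivity)]
  refine (norm_toEuclideanCLM_sq_le _).trans ?_
  have e := lineMatrix_map b n t (fun k => T (ellTwoBasis k))
    (g : StrongDual ℂ W).toLinearMap
  change (lineMatrix b n t fun k => T (ellTwoBasis k)).map (fun v => (g : StrongDual ℂ W) v) = _ at e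
  rw [e]
  refine (sum_norm_sq_lineMatrix_le b n t _).trans ?_
  -- Pulled back along `T`, the functional `g` lives on `ℓ₂`, where Bessel's inequality applies.
  have hg : ‖(g : StrongDual ℂ W) ∘L T‖ ≤ ‖T‖ :=
    (ContinuousLinearMap.opNorm_comp_le _ _).trans
      (mul_le_of_le_one_left (norm_nonneg _) (mem_closedBall_zero_iff.1 g.2))
  calc ∑ k ∈ Finset.range n, t k ^ 2 * ‖(g : StrongDual ℂ W) (T (ellTwoBasis k))‖ ^ 2
      ≤ ∑ k ∈ Finset.range n, δ ^ 2 * ‖((g : StrongDual ℂ W) ∘L T) (ellTwoBasis k)‖ ^ 2 := by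
        refine Finset.sum_le_sum fun k _ => ?_
        exact mul_le_mul_of_nonneg_right (sq_le_sq.2 ((ht k).trans (le_abs_self δ))) (by positivity)
    _ ≤ δ ^ 2 * ‖T‖ ^ 2 := by
        rw [← Finset.mul_sum]
        gcongr
        exact (sum_norm_sq_dual_ellTwoBasis_le _ _).trans (by gcongr)
    _ = (‖T‖ * δ) ^ 2 := by ring

end EllTwo

/-! ### The gliding hump. -/

section GlidingHump

/-- There are finitely supported weights with unit `ℓ₂`-norm, arbitrarily small supremum, and support
arbitrarily far out. -/
theorem exists_flat_weights (N : ℕ) {δ : ℝ} (hδ : 0 < δ) :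
    ∃ (x : ℕ → ℝ) (M : ℕ), N ≤ M ∧ (∀ k < N, x k = 0) ∧ (∀ k, M ≤ k → x k = 0) ∧
      (∀ k, |x k| ≤ δ) ∧ ∑ k ∈ Finset.range M, x k ^ 2 = 1 := by
  -- The weights are `1 / √d` on a block of length `d`; this choice of `d` makes `1 / √d ≤ δ`.
  obtain ⟨d, hd⟩ := exists_nat_gt (1 / δ ^ 2)
  have hd0 : (0 : ℝ) < d := lt_trans (by positivity) hd
  refine ⟨fun k => if N ≤ k ∧ k < N + d then 1 / √d else 0, N + d, by lia,
    fun k hk => if_neg (by lia), fun k hk => if_neg (by lia), fun k => ?_, ?_⟩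
  · dsimp only
    split_ifs
    · rw [abs_of_nonneg (by positivity), div_le_iff₀ (by positivity), ← div_le_iff₀' hδ]
      refine Real.le_sqrt_of_sq_le ?_
      rw [div_pow, one_pow]
      exact hd.le
    · simpa using hδ.le
  · rw [Finset.sum_range_add, Finset.sum_eq_zero, Finset.sum_congr rfl (g := fun _ => 1 / (d : ℝ))]
    · simp [hd0.ne']
    · intro k hk
      dsimp only
      rw [if_pos ⟨by lia, by simpa using hk⟩, div_pow, Real.sq_sqrt hd0.le, one_pow]
    · intro k hk
      dsimp only
      rw [if_neg (by simp at hk; lia)]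
      simp

/-- A gliding hump: subadditive functions `φ n i` of weights, which are bounded on the unit ball of
`ℓ₂`, controlled by the supremum for each `i`, and tend to `0` as `i → ∞` on finitely supported
weights, are uniformly bounded on some finitely supported weights of any large `ℓ₂`-norm. -/
theorem exists_weights_of_gliding_hump (φ : ℕ → ℕ → (ℕ → ℝ) → ℝ) (K : ℝ) (C : ℕ → ℝ)
    (hadd : ∀ n i s t, φ n i (s + t) ≤ φ n i s + φ n i t)
    (hball : ∀ n i t, (∀ m, ∑ k ∈ Finset.range m, t k ^ 2 ≤ 1) → φ n i t ≤ K)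
    (hsup : ∀ n i t (δ : ℝ), 0 ≤ δ → (∀ k, |t k| ≤ δ) → φ n i t ≤ C i * δ)
    (hlim : ∀ t M, (∀ k, M ≤ k → t k = 0) → ∀ ε > 0, ∃ N, ∀ i ≥ N, ∀ n, φ n i t ≤ ε)
    (m : ℕ) : ∀ ε > 0, ∃ (t : ℕ → ℝ) (M : ℕ), (∀ k, M ≤ k → t k = 0) ∧
      ∑ k ∈ Finset.range M, t k ^ 2 = m ∧ ∀ n i, φ n i t ≤ K + ε := by
  induction m with
  | zero =>
    refine fun ε hε => ⟨0, 0, fun _ _ => rfl, by simp, fun n i => ?_⟩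
    exact (hball n i 0 (by simp)).trans (by linarith)
  | succ m ih =>
    intro ε hε
    obtain ⟨t, M, htM, htm, ht⟩ := ih (ε / 2) (by positivity)
    obtain ⟨N, hN⟩ := hlim t M htM (ε / 2) (by positivity)
    -- Only the constants with `i < N` matter: beyond `N` the old weights are already negligible.
    -- Positivity of `D` allows the flatness `ε / 2 / D` of the new block.
    obtain ⟨D, hD0, hD⟩ : ∃ D : ℝ, 0 < D ∧ ∀ i < N, C i ≤ D := by
      refine ⟨1 + ∑ i ∈ Finset.range N, |C i|, by positivity, fun i hi => ?_⟩
      have h1 := Finset.single_le_sum (f := fun i => |C i|) (fun i _ => abs_nonneg _)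
        (Finset.mem_range.2 hi)
      have h2 := le_abs_self (C i)
      linarith
    obtain ⟨x, M', hMM, hx0, hxM, hxδ, hx1⟩ :=
      exists_flat_weights M (δ := ε / 2 / D) (by positivity)
    refine ⟨t + x, M', fun k hk => ?_, ?_, fun n i => (hadd n i t x).trans ?_⟩
    · simp [htM k (hMM.trans hk), hxM k hk]
    · have h1 : ∀ k, (t + x) k ^ 2 = t k ^ 2 + x k ^ 2 := by
        intro k
        rcases lt_or_ge k M with h | h
        · simp [hx0 k h]
        · simp [htM k h]
      have h2 : ∑ k ∈ Finset.range M', t k ^ 2 = ∑ k ∈ Finset.range M, t k ^ 2 := by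
        refine (Finset.sum_subset (Finset.range_subset_range.2 hMM) fun k _ hk => ?_).symm
        rw [htM k (by simpa using hk)]
        simp
      simp_rw [h1]
      rw [Finset.sum_add_distrib, h2, htm, hx1]
      simp
    -- For `i < N` the old weights give `K + ε / 2` and the flat block `ε / 2`; for `i ≥ N` the old
    -- weights give `ε / 2` and the block, having unit norm, `K`.
    · rcases lt_or_ge i N with h | h
      · have h1 := ht n i
        have h2 := hsup n i x _ (by positivity) hxδ
        have h3 : C i * (ε / 2 / D) ≤ ε / 2 := by
          calc C i * (ε / 2 / D) ≤ D * (ε / 2 / D) := by gcongr; exact hD i h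
            _ = ε / 2 := by field_simp
        linarith
      · have h1 := hN i h n
        have h2 : φ n i x ≤ K := by
          refine hball n i x fun m => ?_
          rw [← hx1]
          rcases le_total m M' with hm | hm
          · exact Finset.sum_le_sum_of_subset_of_nonneg (Finset.range_subset_range.2 hm)
              fun k _ _ => sq_nonneg _
          · refine (Finset.sum_subset (Finset.range_subset_range.2 hm) fun k _ hk => ?_).ge
            rw [hxM k (by simpa using hk)]
            simp
        linarith

end GlidingHump

/-! ### The obstruction to embedding, and lower bounds for the four spaces. -/

section Embeddings

/-- An operator space containing an image of `ℓ₂` on which the rows (or the columns) of weighted basis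
vectors dominate the `ℓ₂`-norm of the weights does not completely isomorphically embed into
a `c₀`-sum of operator spaces completely isomorphic to `MIN(ℓ₂)`. -/
theorem not_completelyIsomorphicallyEmbeds_cZeroSum {V : Type v} [NormedAddCommGroup V]
    [NormedSpace ℂ V] [CompleteSpace V] (T : OperatorSpaceStructure V) (r : EllTwo →ₗᵢ[ℂ] V)
    (b : Bool)
    (hlow : ∀ n, 0 < n → ∀ t : ℕ → ℝ, √(∑ k ∈ Finset.range n, t k ^ 2) ≤
      T.matNorm n (lineMatrix b n t fun k => r (ellTwoBasis k)))
    (Y : ℕ → Type u) [∀ i, NormedAddCommGroup (Y i)]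
    [∀ i, NormedSpace ℂ (Y i)] [∀ i, CompleteSpace (Y i)]
    (S : ∀ i, OperatorSpaceStructure (Y i))
    (hS : ∀ i, CompletelyIsomorphic (S i) (OperatorSpaceStructure.MIN EllTwo)) :
    ¬ CompletelyIsomorphicallyEmbeds T (OperatorSpaceStructure.cZeroSum S) := by
  rintro ⟨f, hf, L, hL⟩
  obtain ⟨K, hK0, hK⟩ := hf.exists_norm_le
  let p : ∀ i, cZeroSum Y →ₗ[ℂ] Y i := fun i =>
    { toFun := fun v => (v : lp Y ⊤) i
      map_add' := fun _ _ => rfl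
      map_smul' := fun _ _ => rfl }
  have hp : ∀ i v, ‖p i v‖ ≤ ‖v‖ := fun i v => lp.norm_apply_le_norm (by simp) (v : lp Y ⊤) i
  let F : ∀ i, EllTwo →ₗ[ℂ] Y i := fun i => p i ∘ₗ f ∘ₗ r.toLinearMap
  have hF : ∀ i x, ‖F i x‖ ≤ K * ‖x‖ := fun i x =>
    (hp i _).trans ((hK _).trans_eq (by rw [LinearIsometry.coe_toLinearMap, r.norm_map]))
  have hF0 : ∀ x, Filter.Tendsto (fun i => ‖F i x‖) Filter.atTop (nhds 0) := fun x => (f (r x)).2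
  have hCex : ∀ i, ∃ C : ℝ, ∀ n (t : ℕ → ℝ) (δ : ℝ), 0 ≤ δ → (∀ k, |t k| ≤ δ) →
      (S i).matNorm n (lineMatrix b n t fun k => F i (ellTwoBasis k)) ≤ C * δ := by
    intro i
    -- The line is moved to `MIN(ℓ₂)` by `e`, estimated there, and brought back by `e.symm`. For
    -- `e`, boundedness suffices, to make `G` continuous; for `e.symm` the estimate is needed at all
    -- matrix sizes.
    obtain ⟨e, he, A, hA⟩ := hS i
    obtain ⟨B, hB0, hB⟩ := he.exists_norm_le
    let G : EllTwo →L[ℂ] EllTwo := (e.toLinearMap ∘ₗ F i).mkContinuous (B * K) fun x => by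
      refine (hB _).trans ?_
      rw [mul_assoc]
      gcongr
      exact hF i x
    refine ⟨|A| * ‖G‖, fun n t δ hδ ht => ?_⟩
    have h1 := hA n (lineMatrix b n t fun k => G (ellTwoBasis k))
    rw [lineMatrix_map] at h1
    have h2 : (fun k => e.symm.toLinearMap (G (ellTwoBasis k))) = fun k => F i (ellTwoBasis k) := by
      funext k
      exact e.symm_apply_apply _
    rw [h2] at h1
    refine h1.trans ?_
    rw [mul_assoc]
    exact mul_le_mul (le_abs_self A) (matNorm_MIN_lineMatrix_le G b n t hδ ht)
      (OperatorSpaceStructure.matNorm_nonneg _ _ _) (abs_nonneg A)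
  choose C hC using hCex
  -- Weights with `‖t‖₂² = m` and image norm at most `K + 1` will violate the lower estimate for
  -- `f`.
  obtain ⟨m, hm⟩ := exists_nat_gt ((|L| * (K + 1)) ^ 2)
  -- The matrix size `n` stays free, since the size `M` used at the end is known only once the
  -- weights are built.
  obtain ⟨t, M, -, htm, ht⟩ := exists_weights_of_gliding_hump
    (fun n i t => (S i).matNorm n (lineMatrix b n t fun k => F i (ellTwoBasis k))) K C
    (fun n i s t => by
      rw [lineMatrix_add]
      exact (S i).matNorm_add_le n _ _)
    (fun n i t ht => by
      refine (sq_le_sq₀ ((S i).matNorm_nonneg _ _) hK0).1 ?_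
      refine ((S i).matNorm_lineMatrix_sq_le b n t _).trans ?_
      calc ∑ k ∈ Finset.range n, t k ^ 2 * ‖F i (ellTwoBasis k)‖ ^ 2
          ≤ ∑ k ∈ Finset.range n, t k ^ 2 * K ^ 2 := by
            gcongr with k _
            simpa [norm_ellTwoBasis] using hF i (ellTwoBasis k)
        _ ≤ K ^ 2 := by
            rw [← Finset.sum_mul]
            exact mul_le_of_le_one_left (sq_nonneg K) (ht n))
    (fun n i => hC i n)
    (fun t M htM ε hε => by
      have h1 : Filter.Tendsto
          (fun i => ∑ k ∈ Finset.range M, t k ^ 2 * ‖F i (ellTwoBasis k)‖ ^ 2)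
          Filter.atTop (nhds 0) := by
        have h2 := tendsto_finsetSum (Finset.range M) fun k _ =>
          ((hF0 (ellTwoBasis k)).pow 2).const_mul (t k ^ 2)
        simpa using h2
      obtain ⟨N, hN⟩ := Filter.eventually_atTop.1 (h1.eventually_le_const (sq_pos_of_pos hε))
      refine ⟨N, fun i hi n => (sq_le_sq₀ ((S i).matNorm_nonneg _ _) hε.le).1 ?_⟩
      refine ((S i).matNorm_lineMatrix_sq_le b n t _).trans (le_trans ?_ (hN i hi))
      rcases le_total n M with hn | hn
      · exact Finset.sum_le_sum_of_subset_of_nonneg (Finset.range_subset_range.2 hn)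
          fun k _ _ => by positivity
      · refine (Finset.sum_subset (Finset.range_subset_range.2 hn) fun k _ hk => ?_).ge
        rw [htM k (by simpa using hk)]
        simp)
    m 1 one_pos
  have hm0 : (0 : ℝ) < m := lt_of_le_of_lt (sq_nonneg _) hm
  have hM : 0 < M := by
    rcases Nat.eq_zero_or_pos M with rfl | h
    · simp at htm
      exact absurd htm hm0.ne
    · exact h
  have h1 := (hlow M hM t).trans (hL M _)
  have h2 : (OperatorSpaceStructure.cZeroSum S).matNorm M
      ((lineMatrix b M t fun k => r (ellTwoBasis k)).map f) ≤ K + 1 := by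
    refine ciSup_le fun i => ?_
    have e := lineMatrix_map b M t (fun k => r (ellTwoBasis k)) (p i ∘ₗ f)
    refine le_trans (le_of_eq ?_) (ht M i)
    exact congrArg ((S i).matNorm M) e
  rw [htm] at h1
  have h3 : √(m : ℝ) ≤ |L| * (K + 1) :=
    h1.trans (mul_le_mul (le_abs_self L) h2 (OperatorSpaceStructure.matNorm_nonneg _ _ _)
      (abs_nonneg L))
  rw [Real.sqrt_le_left (by positivity)] at h3
  exact absurd h3 (not_le.2 hm)

/-- The row is tested on the vector with entries `t k • e k`: as `e_0k` maps `e k` to `e 0`, all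
terms add up in one direction. The orientation matters, since a column of these operators has norm
only `sup |t k|`. -/
theorem sqrt_le_norm_matrixOperator_row {n : ℕ} (hn : 0 < n) (t : ℕ → ℝ) :
    √(∑ k ∈ Finset.range n, t k ^ 2) ≤
      ‖matrixOperator (lineMatrix true n t fun k => rowOperator (ellTwoBasis k))‖ := by
  set a : ℝ := ∑ k ∈ Finset.range n, t k ^ 2 with ha
  have ha0 : 0 ≤ a := by positivity
  set A := lineMatrix true n t fun k => rowOperator (ellTwoBasis k) with hA
  let ξ : PiLp 2 fun _ : Fin n => EllTwo :=
    WithLp.toLp 2 fun k => (t k : ℂ) • ellTwoBasis k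
  have hξ : ‖ξ‖ = √a := by
    rw [PiLp.norm_eq_of_L2, ha, Finset.sum_range]
    simp [-Complex.coe_smul, ξ, norm_smul, norm_ellTwoBasis]
  have h0 : matrixOperator A ξ ⟨0, hn⟩ = (a : ℂ) • ellTwoBasis 0 := by
    rw [matrixOperator_apply, ha, Finset.sum_range, Complex.ofReal_sum, Finset.sum_smul]
    refine Finset.sum_congr rfl fun j _ => ?_
    have e : A ⟨0, hn⟩ j = (t j : ℂ) • matrixUnit 0 j := by
      rw [← rowOperator_basis]
      simp [hA, lineMatrix]
    rw [e]
    simp only [ξ, smul_apply, map_smul, matrixUnit_apply_basis, if_true,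
      smul_smul]
    push_cast
    rw [sq]
  have h1 : a ≤ ‖matrixOperator A‖ * √a := by
    have h2 := (PiLp.norm_apply_le (matrixOperator A ξ) ⟨0, hn⟩).trans
      ((matrixOperator A).le_opNorm ξ)
    rw [h0, hξ, norm_smul, norm_ellTwoBasis, mul_one, Complex.norm_real, Real.norm_of_nonneg ha0]
      at h2
    exact h2
  rcases ha0.eq_or_lt with h | h
  · rw [← h, Real.sqrt_zero]
    exact norm_nonneg _
  · refine le_of_mul_le_mul_right ?_ (Real.sqrt_pos.2 h)
    rwa [Real.mul_self_sqrt ha0]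

/-- Testing on `e 0` in the first slot spreads the weights over orthogonal vectors `t i • e i`. -/
theorem sqrt_le_norm_matrixOperator_column {n : ℕ} (hn : 0 < n) (t : ℕ → ℝ) :
    √(∑ k ∈ Finset.range n, t k ^ 2) ≤
      ‖matrixOperator (lineMatrix false n t fun k => columnOperator (ellTwoBasis k))‖ := by
  set A := lineMatrix false n t fun k => columnOperator (ellTwoBasis k) with hA
  let ξ : PiLp 2 fun _ : Fin n => EllTwo := PiLp.single 2 ⟨0, hn⟩ (ellTwoBasis 0)
  have hξ : ‖ξ‖ = 1 := by
    rw [PiLp.norm_single, norm_ellTwoBasis]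
  have h0 : ∀ i, matrixOperator A ξ i = (t i : ℂ) • ellTwoBasis i := by
    intro i
    rw [matrixOperator_apply, Finset.sum_eq_single ⟨0, hn⟩]
    · have e : A i ⟨0, hn⟩ = (t i : ℂ) • matrixUnit i 0 := by
        rw [← columnOperator_basis]
        simp [hA, lineMatrix]
      rw [e]
      simp [-Complex.coe_smul, ξ, matrixUnit_apply_basis]
    · intro j _ hj
      simp [ξ, hj]
    · simp
  have h1 := (matrixOperator A).le_opNorm ξ
  rw [hξ, mul_one] at h1
  refine le_trans (le_of_eq ?_) h1
  rw [PiLp.norm_eq_of_L2, Finset.sum_range]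
  simp [-Complex.coe_smul, h0, norm_smul, norm_ellTwoBasis]

theorem norm_matrixOperator_le_matNorm_MAX {V : Type u} [NormedAddCommGroup V] [NormedSpace ℂ V]
    [CompleteSpace V] {H : Type u} [NormedAddCommGroup H] [InnerProductSpace ℂ H] [CompleteSpace H]
    (w : V →L[ℂ] (H →L[ℂ] H)) (hw : ‖w‖ ≤ 1) (n : ℕ) (x : Matrix (Fin n) (Fin n) V) :
    ‖matrixOperator (x.map w)‖ ≤ (OperatorSpaceStructure.MAX V).matNorm n x := by
  -- The real `sSup` of an unbounded set is `0`, so an upper bound must be supplied.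
  refine le_csSup ⟨∑ k, ∑ l, ‖x k l‖, ?_⟩ ⟨H, _, _, inferInstance, w, hw, rfl⟩
  rintro _ ⟨H', _, _, _, w', hw', rfl⟩
  refine (norm_matrixOperator_le_sum _).trans ?_
  gcongr with k _ l _
  simpa using w'.le_of_opNorm_le hw' (x k l)

theorem sqrt_le_matNorm_row {n : ℕ} (hn : 0 < n) (t : ℕ → ℝ) :
    √(∑ k ∈ Finset.range n, t k ^ 2) ≤ OperatorSpaceStructure.row.matNorm n
      (lineMatrix true n t fun k => rowIsometry (ellTwoBasis k)) := by
  have e := lineMatrix_map true n t (fun k => rowIsometry (ellTwoBasis k)) rowSubspace.subtype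
  have h := sqrt_le_norm_matrixOperator_row hn t
  change _ = lineMatrix true n t fun k => rowOperator (ellTwoBasis k) at e
  rw [← e] at h
  exact h

theorem sqrt_le_matNorm_column {n : ℕ} (hn : 0 < n) (t : ℕ → ℝ) :
    √(∑ k ∈ Finset.range n, t k ^ 2) ≤ OperatorSpaceStructure.column.matNorm n
      (lineMatrix false n t fun k => columnIsometry (ellTwoBasis k)) := by
  have e := lineMatrix_map false n t (fun k => columnIsometry (ellTwoBasis k))
    columnSubspace.subtype
  have h := sqrt_le_norm_matrixOperator_column hn t
  change _ = lineMatrix false n t fun k => columnOperator (ellTwoBasis k) at e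
  rw [← e] at h
  exact h

theorem sqrt_le_matNorm_rowInterColumn {n : ℕ} (hn : 0 < n) (t : ℕ → ℝ) :
    √(∑ k ∈ Finset.range n, t k ^ 2) ≤ OperatorSpaceStructure.rowInterColumn.matNorm n
      (lineMatrix true n t ellTwoBasis) := by
  have e := lineMatrix_map true n t ellTwoBasis rowIsometry.toLinearMap
  have h := sqrt_le_matNorm_row hn t
  change _ = lineMatrix true n t fun k => rowIsometry (ellTwoBasis k) at e
  rw [← e] at h
  exact h.trans (le_max_left _ _)

/-- `rowOperator` is isometric, hence one of the contractions over which the maximal norm is a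
supremum. -/
theorem sqrt_le_matNorm_MAX {n : ℕ} (hn : 0 < n) (t : ℕ → ℝ) :
    √(∑ k ∈ Finset.range n, t k ^ 2) ≤ (OperatorSpaceStructure.MAX EllTwo).matNorm n
      (lineMatrix true n t ellTwoBasis) := by
  have e := lineMatrix_map true n t ellTwoBasis rowOperator.toLinearMap
  have h := sqrt_le_norm_matrixOperator_row hn t
  change _ = lineMatrix true n t fun k => rowOperator (ellTwoBasis k) at e
  rw [← e] at h
  exact h.trans (norm_matrixOperator_le_matNorm_MAX rowOperator.toContinuousLinearMap
    rowOperator.norm_toContinuousLinearMap_le n _)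

end Embeddings

theorem mainTheorem5 (Y : ℕ → Type u) [∀ i, NormedAddCommGroup (Y i)]
    [∀ i, NormedSpace ℂ (Y i)] [∀ i, CompleteSpace (Y i)]
    (S : ∀ i, OperatorSpaceStructure (Y i))
    (hS : ∀ i, CompletelyIsomorphic (S i) (OperatorSpaceStructure.MIN EllTwo)) :
    ¬ CompletelyIsomorphicallyEmbeds OperatorSpaceStructure.row
        (OperatorSpaceStructure.cZeroSum S) ∧
      ¬ CompletelyIsomorphicallyEmbeds OperatorSpaceStructure.column
        (OperatorSpaceStructure.cZeroSum S) ∧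
      ¬ CompletelyIsomorphicallyEmbeds OperatorSpaceStructure.rowInterColumn
        (OperatorSpaceStructure.cZeroSum S) ∧
      ¬ CompletelyIsomorphicallyEmbeds (OperatorSpaceStructure.MAX EllTwo)
        (OperatorSpaceStructure.cZeroSum S) := by
  have hR : ¬ CompletelyIsomorphicallyEmbeds OperatorSpaceStructure.row
      (OperatorSpaceStructure.cZeroSum S) :=
    not_completelyIsomorphicallyEmbeds_cZeroSum OperatorSpaceStructure.row rowIsometry true
      (fun n hn t => sqrt_le_matNorm_row (n := n) hn t) Y S hS
  have hC : ¬ CompletelyIsomorphicallyEmbeds OperatorSpaceStructure.column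
      (OperatorSpaceStructure.cZeroSum S) :=
    not_completelyIsomorphicallyEmbeds_cZeroSum OperatorSpaceStructure.column columnIsometry false
      (fun n hn t => sqrt_le_matNorm_column (n := n) hn t) Y S hS
  have hRC : ¬ CompletelyIsomorphicallyEmbeds OperatorSpaceStructure.rowInterColumn
      (OperatorSpaceStructure.cZeroSum S) :=
    not_completelyIsomorphicallyEmbeds_cZeroSum OperatorSpaceStructure.rowInterColumn
      LinearIsometry.id true (fun n hn t => sqrt_le_matNorm_rowInterColumn (n := n) hn t) Y S hS
  have hM : ¬ CompletelyIsomorphicallyEmbeds (OperatorSpaceStructure.MAX EllTwo)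
      (OperatorSpaceStructure.cZeroSum S) :=
    not_completelyIsomorphicallyEmbeds_cZeroSum (OperatorSpaceStructure.MAX EllTwo)
      LinearIsometry.id true (fun n hn t => sqrt_le_matNorm_MAX (n := n) hn t) Y S hS
  exact ⟨hR, hC, hRC, hM⟩
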